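/- **Setting.** Let $T>0$, $\alpha>0$, let $\Omega\subset\mathbb{R}^d$ be open and let $A$ be a uniformly elliptic second order operator $Ay=\sum_i\partial_i\big(\sum_j a_{ij}\partial_j y+b_i y\big)+\sum_j c_j\partial_j y+e\,y$ on $\Omega$ with bounded measurable coefficients. Let $\omega_1,\dots,\omega_N\subset\Omega$ be measurable sets of positive measure, $(Bu)(t,x)=\sum_{i=1}^N\chi_{\omega_i}(x)u_i(t)$, $y_0\in L^2(\Omega)$, let $\omega_{\mathrm{obs}}\subset\Omega$ be measurable and $y^d\in L^2(0,T;L^2(\omega_{\mathrm{obs}}))$. Fix boundary conditions, given as the set of those functions in $L^2((0,T)\times\Omega)$ that satisfy them. Assume, as a standing assumption, that for every $u\in U:=L^2(0,T;\mathbb{R}^N)$ (where $\mathbb{R}^N$ has the Euclidean norm) the state equation $\partial_t y-Ay=Bu$ in $(0,T)\times\Omega$, $y(0)=y_0$, has a unique weak solution $y=S(u)\in L^2(0,T;H^1(\Omega))$ that satisfies the boundary conditions, and that the solution operator $S:U\to L^2((0,T)\times\Omega)$ is affine and continuous. Set $$\mathcal{F}(u)=\tfrac12\|S(u)-y^d\|^2_{L^2(0,T;L^2(\omega_{\mathrm{obs}}))},\qquad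 \mathcal{G}(u)=\tfrac\alpha2\int_0^T\Big(\sum_{j=1}^N|u_j(t)|\Big)^2dt,\qquad u\in U.$$ Let $\mathcal{G}^*(p)=\sup_{u\in U}\,\langle p,u\rangle-\mathcal{G}(u)$ be the Fenchel conjugate, $\partial\mathcal{G}^*$ its convex subdifferential and, for $\gamma>0$, $(\partial\mathcal{G}^*)_\gamma(p)=\frac1\gamma\big(p-\mathrm{prox}_{\gamma\mathcal{G}^*}(p)\big)$ its Yosida regularization, where $\mathrm{prox}_{\gamma\mathcal{G}^*}(v)=\operatorname{arg\,min}_{w\in U}\frac1{2\gamma}\|w-v\|_U^2+\mathcal{G}^*(w)$. With the Fréchet derivative $\mathcal{F}'(u)$ identified with an element of $U$, consider the optimality system and its regularization for $(u,p)\in U\times U$: $$\text{(OS)}\quad -p=\mathcal{F}'(u),\quad u\in\partial\mathcal{G}^*(p);\qquad\qquad \text{(OS}_\gamma)\quad -p=\mathcal{F}'(u),\quad u=(\partial\mathcal{G}^*)_\gamma(p).$$ **Proposition.** Let $(\gamma_n)_{n\in\mathbb{N}}$ be a sequence of positive numbers with $\gamma_n\to0$ and, for each $n$, let $(u_{\gamma_n},p_{\gamma_n})\in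 U\times U$ be a solution of $(\mathrm{OS}_{\gamma_n})$. Then there is a solution $(\bar u,\bar p)\in U\times U$ of (OS) such that the whole sequence $(u_{\gamma_n},p_{\gamma_n})$ converges weakly in $U\times U$ to $(\bar u,\bar p)$. -/

import Mathlib

open MeasureTheory Set Filter Topology

noncomputable section

namespace SwitchingControl

/-! ### Function spaces -/

/-- The Euclidean space `ℝᵈ`. -/
abbrev Eucl (d : ℕ) : Type := EuclideanSpace ℝ (Fin d)

/-- The control space `L²(0,T;ℝᴺ)`, with `ℝᴺ` carrying the Euclidean norm. -/
abbrev Control (T : ℝ) (N : ℕ) : Type :=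
  Lp (Eucl N) 2 (volume.restrict (Ioo (0 : ℝ) T))

/-- The cylinder `(0,T) × ω`. -/
def spaceTime {d : ℕ} (T : ℝ) (ω : Set (Eucl d)) : Set (ℝ × Eucl d) := Ioo (0 : ℝ) T ×ˢ ω

/-- The space `L²(0,T;L²(ω)) = L²((0,T) × ω)`. -/
abbrev SpaceTimeL2 {d : ℕ} (T : ℝ) (ω : Set (Eucl d)) : Type :=
  Lp ℝ 2 (volume.restrict (spaceTime T ω))

/-! ### The state equation -/

/-- A uniformly elliptic second order operator on `Ω` with bounded measurable coefficients,
`A y = ∑ᵢ ∂ᵢ (∑ⱼ aᵢⱼ ∂ⱼ y + bᵢ y) + ∑ⱼ cⱼ ∂ⱼ y + e y`. -/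
structure EllipticOperator {d : ℕ} (Ω : Set (Eucl d)) where
  a : Fin d → Fin d → Eucl d → ℝ
  b : Fin d → Eucl d → ℝ
  c : Fin d → Eucl d → ℝ
  e : Eucl d → ℝ
  measurable_a : ∀ i j, Measurable (a i j)
  measurable_b : ∀ i, Measurable (b i)
  measurable_c : ∀ i, Measurable (c i)
  measurable_e : Measurable e
  bounded : ∃ M : ℝ, ∀ x ∈ Ω,
    (∀ i j, |a i j x| ≤ M) ∧ (∀ i, |b i x| ≤ M) ∧ (∀ i, |c i x| ≤ M) ∧ |e x| ≤ M
  elliptic : ∃ κ : ℝ, 0 < κ ∧ ∀ x ∈ Ω, ∀ ξ : Eucl d,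
    κ * ‖ξ‖ ^ 2 ≤ ∑ i, ∑ j, a i j x * ξ i * ξ j

/-- The time derivative of a smooth function of `(t, x)`. -/
def dt {d : ℕ} (φ : ℝ × Eucl d → ℝ) (z : ℝ × Eucl d) : ℝ :=
  fderiv ℝ φ z (1, 0)

/-- The `i`-th partial derivative in space of a smooth function of `(t, x)`. -/
def dx {d : ℕ} (i : Fin d) (φ : ℝ × Eucl d → ℝ) (z : ℝ × Eucl d) : ℝ :=
  fderiv ℝ φ z (0, EuclideanSpace.single i 1)

/-- `φ ∈ C_c^∞(U)`. -/
def IsTest {d : ℕ} (U : Set (ℝ × Eucl d)) (φ : ℝ × Eucl d → ℝ) : Prop :=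
  ContDiff ℝ (⊤ : ℕ∞) φ ∧ HasCompactSupport φ ∧ tsupport φ ⊆ U

/-- `D` is the weak gradient of `y` in the space variables on `(0,T) × Ω`. If there is such a
`D` with components in `L²`, then `y ∈ L²(0,T;H¹(Ω))`. -/
def IsWeakSpaceGradient {d : ℕ} {T : ℝ} {Ω : Set (Eucl d)}
    (y : SpaceTimeL2 T Ω) (D : Fin d → SpaceTimeL2 T Ω) : Prop :=
  ∀ i, ∀ φ : ℝ × Eucl d → ℝ, IsTest (spaceTime T Ω) φ →
    ∫ z in spaceTime T Ω, y z * dx i φ z = - ∫ z in spaceTime T Ω, D i z * φ z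

/-- The control operator, `(B u)(t, x) = ∑ᵢ χ_{ωᵢ}(x) uᵢ(t)`. -/
def controlOp {d N : ℕ} {T : ℝ} (ω : Fin N → Set (Eucl d)) (u : Control T N)
    (z : ℝ × Eucl d) : ℝ :=
  ∑ i, (ω i).indicator (fun _ => (1 : ℝ)) z.2 * u z.1 i

/-- `y ∈ L²(0,T;H¹(Ω))` is a weak solution of `∂ₜ y - A y = B u` in `(0,T) × Ω`, `y(0) = y₀`
in `Ω`. The test functions are compactly supported in `(-∞,T) × Ω`, hence do not have to vanish
at the initial time, and the initial condition is part of the identity. Nothing is said here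
about the behaviour of `y` at `∂Ω`. -/
def IsWeakSolution {d N : ℕ} {T : ℝ} {Ω : Set (Eucl d)} (A : EllipticOperator Ω)
    (ω : Fin N → Set (Eucl d)) (y₀ : Lp ℝ 2 (volume.restrict Ω))
    (u : Control T N) (y : SpaceTimeL2 T Ω) : Prop :=
  ∃ D : Fin d → SpaceTimeL2 T Ω, IsWeakSpaceGradient y D ∧
    ∀ φ : ℝ × Eucl d → ℝ, IsTest (Iio T ×ˢ Ω) φ →
      ∫ z in spaceTime T Ω,
          (- (y z * dt φ z)
            + ∑ i, (∑ j, A.a i j z.2 * D j z + A.b i z.2 * y z) * dx i φ z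
            - (∑ j, A.c j z.2 * D j z + A.e z.2 * y z) * φ z)
        = (∫ z in spaceTime T Ω, controlOp ω u z * φ z) + ∫ x in Ω, y₀ x * φ (0, x)

/-- `S` is the solution operator of the state equation with the boundary conditions `bc`
(given as the set of all functions that satisfy them): for each control `u`, the state `S u` is
the unique function that satisfies the boundary conditions and weakly solves
`∂ₜ y - A y = B u`, `y(0) = y₀`. -/
def IsSolutionOperator {d N : ℕ} {T : ℝ} {Ω : Set (Eucl d)} (A : EllipticOperator Ω)
    (ω : Fin N → Set (Eucl d)) (y₀ : Lp ℝ 2 (volume.restrict Ω))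
    (bc : Set (SpaceTimeL2 T Ω)) (S : Control T N → SpaceTimeL2 T Ω) : Prop :=
  ∀ u, S u ∈ bc ∧ IsWeakSolution A ω y₀ u (S u) ∧
    ∀ y ∈ bc, IsWeakSolution A ω y₀ u y → y = S u

/-! ### The two parts of the objective -/

/-- `F(u) = ½ ‖S u - y_d‖²` in `L²(0,T;L²(ω_obs))`. -/
def trackingF {d N : ℕ} {T : ℝ} {Ω ωobs : Set (Eucl d)}
    (S : Control T N → SpaceTimeL2 T Ω) (yd : SpaceTimeL2 T ωobs) (u : Control T N) : ℝ :=
  (1 / 2) * ∫ z in spaceTime T ωobs, (S u z - yd z) ^ 2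

/-- `G(u) = (α/2) ∫₀ᵀ |u(t)|₁² dt`. -/
def penaltyG {N : ℕ} {T : ℝ} (α : ℝ) (u : Control T N) : ℝ :=
  (α / 2) * ∫ t in Ioo (0 : ℝ) T, (∑ j, |u t j|) ^ 2

/-! ### Convex analysis in a real Hilbert space -/

section Convex

variable {X : Type*} [NormedAddCommGroup X] [InnerProductSpace ℝ X]

/-- The Fenchel conjugate `H*(p) = sup_u ⟪p, u⟫ - H(u)`. -/
def fenchelConj (H : X → EReal) (p : X) : EReal :=
  ⨆ u : X, ((inner ℝ p u : ℝ) : EReal) - H u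

/-- The convex subdifferential `∂H(p)` of a proper function `H`. -/
def subdiff (H : X → EReal) (p : X) : Set X :=
  {u | ∀ q : X, H p + ((inner ℝ u (q - p) : ℝ) : EReal) ≤ H q}

/-- `w = prox_{γH}(v)`: `w` minimizes `‖w - v‖² / (2γ) + H(w)`. -/
def IsProx (γ : ℝ) (H : X → EReal) (v w : X) : Prop :=
  IsMinOn (fun w' : X => ((1 / (2 * γ) * ‖w' - v‖ ^ 2 : ℝ) : EReal) + H w') univ w

/-- `u = (∂H)_γ(p) = (p - prox_{γH}(p)) / γ`, the Yosida regularization of `∂H`. -/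
def IsYosida (γ : ℝ) (H : X → EReal) (p u : X) : Prop :=
  ∃ w, IsProx γ H p w ∧ u = (1 / γ) • (p - w)

variable [CompleteSpace X]

/-- The optimality system: `-p = F'(u)`, `u ∈ ∂G*(p)`. -/
def SolvesOS (F G : X → ℝ) (u p : X) : Prop :=
  HasGradientAt F (-p) u ∧ u ∈ subdiff (fenchelConj fun v => (G v : EReal)) p

/-- The regularized optimality system: `-p = F'(u)`, `u = (∂G*)_γ(p)`. -/
def SolvesOSReg (F G : X → ℝ) (γ : ℝ) (u p : X) : Prop :=
  HasGradientAt F (-p) u ∧ IsYosida γ (fenchelConj fun v => (G v : EReal)) p u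

end Convex

end SwitchingControl

end

namespace SwitchingControl

/-! ### Tikhonov-type convergence in an abstract Hilbert space -/

section Convex

variable {X : Type*} [NormedAddCommGroup X] [InnerProductSpace ℝ X]

/-! Since `S` is affine and continuous, F(u) = ½‖Lu + c‖², so -p_n = L*(Lu_n + c), and it suffices
that u_n converges. The Yosida relation says that u_n is a subgradient of G* at w_n = p_n - γ_n u_n.
Monotonicity of ∂G* and ⟨p_n - p_m, u_n - u_m⟩ = -‖L(u_n - u_m)‖² ≤ 0 give ⟨γ_n u_n - γ_m u_m, u_n -
u_m⟩ ≤ 0. As for Tikhonov regularization, this relation and a uniform bound make u_n Cauchy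
(`cauchySeq_of_inner_smul_sub_nonpos`). Convergence is thus strong and holds for the whole sequence,
with no appeal to uniqueness for the limit system; the subgradient inequality passes to the limit
because G* is a supremum of continuous affine functions. -/

/-- A bounded sequence satisfying the monotonicity relation of Tikhonov regularization converges
strongly as the regularization parameter vanishes. -/
theorem cauchySeq_of_inner_smul_sub_nonpos {γ : ℕ → ℝ} {u : ℕ → X} (hγ : ∀ n, 0 < γ n)
    (hγ0 : Tendsto γ atTop (𝓝 0)) {C : ℝ} (hC : ∀ n, ‖u n‖ ≤ C)
    (h : ∀ n m, inner ℝ (γ n • u n - γ m • u m) (u n - u m) ≤ 0) : CauchySeq u := by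
  -- Norms grow as the parameter shrinks, with the gap controlling the squared distance.
  have key : ∀ n m, γ n ≤ γ m → ‖u n - u m‖ ^ 2 ≤ ‖u n‖ ^ 2 - ‖u m‖ ^ 2 := by
    intro n m hnm
    have h1 : inner ℝ (γ n • u n - γ m • u m) (u n - u m)
        = γ n * ‖u n - u m‖ ^ 2 - (γ m - γ n) * inner ℝ (u m) (u n - u m) := by
      rw [← real_inner_self_eq_norm_sq]
      simp only [inner_sub_left, inner_sub_right, real_inner_smul_left]
      ring
    have h2 := h n m
    rw [h1] at h2
    have h3 : ‖u n‖ ^ 2 - ‖u m‖ ^ 2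
        = ‖u n - u m‖ ^ 2 + 2 * inner ℝ (u m) (u n - u m) := by
      simp only [← real_inner_self_eq_norm_sq, inner_sub_left, inner_sub_right,
        real_inner_comm (u m) (u n)]
      ring
    rw [h3]
    rcases hnm.eq_or_lt with heq | hlt
    · have h4 : γ n * ‖u n - u m‖ ^ 2 ≤ 0 := by
        rw [heq] at h2 ⊢; linarith
      have h5 : ‖u n - u m‖ ^ 2 ≤ 0 := nonpos_of_mul_nonpos_right h4 (hγ n)
      have h6 : u n - u m = 0 := by
        rw [← norm_eq_zero]; exact pow_eq_zero_iff two_ne_zero |>.1 (le_antisymm h5 (sq_nonneg _))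
      simp [h6]
    · have h4 : 0 ≤ γ n * ‖u n - u m‖ ^ 2 := mul_nonneg (hγ n).le (sq_nonneg _)
      have h5 : 0 ≤ inner ℝ (u m) (u n - u m) :=
        by
        by_contra! hneg
        linarith [mul_neg_of_pos_of_neg (sub_pos.2 hlt) hneg]
      linarith
  have hbdd : BddAbove (range fun n => ‖u n‖ ^ 2) := by
    refine ⟨C ^ 2, ?_⟩
    rintro _ ⟨n, rfl⟩
    exact pow_le_pow_left₀ (norm_nonneg _) (hC n) 2
  rw [Metric.cauchySeq_iff']
  intro ε hε
  -- `M` nearly attains the supremum of the squared norms. Every later `n` with `γ n < γ M` is then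
  -- close to `u M`, so `γ` need not be monotone.
  obtain ⟨M, hM⟩ := exists_lt_of_lt_ciSup
    (show (⨆ n, ‖u n‖ ^ 2) - (ε / 2) ^ 2 < ⨆ n, ‖u n‖ ^ 2 by
      have : 0 < (ε / 2) ^ 2 := by positivity
      linarith)
  obtain ⟨K, hK⟩ := eventually_atTop.1 (hγ0.eventually_lt_const (hγ M))
  have hd : ∀ n ≥ K, dist (u n) (u M) < ε / 2 := by
    intro n hn
    rw [dist_eq_norm]
    refine lt_of_pow_lt_pow_left₀ 2 (by positivity) ?_
    have h1 := key n M (hK n hn).le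
    have h2 := le_ciSup hbdd n
    linarith
  refine ⟨K, fun n hn => ?_⟩
  have := dist_triangle_right (u n) (u K) (u M)
  linarith [hd n hn, hd K le_rfl]

/-- The conjugate of a function with quadratic growth is real-valued. -/
theorem exists_fenchelConj_eq_coe {G : X → ℝ} {α : ℝ} (hα : 0 < α) (hG0 : G 0 = 0)
    (hG : ∀ v, α / 2 * ‖v‖ ^ 2 ≤ G v) :
    ∃ g : X → ℝ, (fenchelConj fun v => (G v : EReal)) = (fun p => (g p : EReal)) ∧
      (∀ p, IsLUB (range fun v => inner ℝ p v - G v) (g p)) ∧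
      ∀ p, 0 ≤ g p ∧ g p ≤ 1 / (2 * α) * ‖p‖ ^ 2 := by
  have hup : ∀ p v, inner ℝ p v - G v ≤ 1 / (2 * α) * ‖p‖ ^ 2 := by
    intro p v
    have h1 := real_inner_le_norm p v
    -- Young's inequality with weight α, by completing the square.
    have h2 : 0 ≤ (‖p‖ - α * ‖v‖) ^ 2 / (2 * α) := by positivity
    have h3 : (‖p‖ - α * ‖v‖) ^ 2 / (2 * α)
        = 1 / (2 * α) * ‖p‖ ^ 2 - ‖p‖ * ‖v‖ + α / 2 * ‖v‖ ^ 2 := by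
      field_simp
      ring
    linarith [hG v]
  have hlub : ∀ p, IsLUB (range fun v => inner ℝ p v - G v) (⨆ v, (inner ℝ p v - G v)) :=
    fun p => isLUB_ciSup ⟨_, by rintro _ ⟨v, rfl⟩; exact hup p v⟩
  refine ⟨fun p => ⨆ v, (inner ℝ p v - G v), ?_, hlub, fun p => ⟨?_, ciSup_le (hup p)⟩⟩
  · funext p
    refine le_antisymm (iSup_le fun v => ?_) ?_
    · rw [← EReal.coe_sub]
      exact EReal.coe_le_coe_iff.2 ((hlub p).1 ⟨v, rfl⟩)
    · refine EReal.le_of_forall_lt_iff_le.1 fun z hz => ?_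
      refine EReal.coe_le_coe_iff.2 ((hlub p).2 ?_)
      rintro _ ⟨v, rfl⟩
      have h1 := (le_iSup (fun v : X => ((inner ℝ p v : ℝ) : EReal) - (G v : EReal)) v).trans_lt hz
      rw [← EReal.coe_sub] at h1
      exact (EReal.coe_lt_coe_iff.1 h1).le
  · have := (hlub p).1 ⟨0, rfl⟩
    simpa [hG0] using this

/-- The Yosida regularization at `p` is a subgradient at the proximal point `p - γ u`. -/
theorem IsYosida.inner_le {g : X → ℝ} (hg : ConvexOn ℝ univ g) {γ : ℝ} (hγ : 0 < γ) {p u : X}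
    (h : IsYosida γ (fun q => (g q : EReal)) p u) (q : X) :
    g (p - γ • u) + inner ℝ u (q - (p - γ • u)) ≤ g q := by
  obtain ⟨w, hw, rfl⟩ := h
  have hpw : p - γ • (1 / γ) • (p - w) = w := by
    rw [smul_smul, mul_one_div_cancel hγ.ne', one_smul, sub_sub_cancel]
  rw [hpw, real_inner_smul_left]
  have hmin : ∀ z, 1 / (2 * γ) * ‖w - p‖ ^ 2 + g w ≤ 1 / (2 * γ) * ‖z - p‖ ^ 2 + g z := by
    intro z
    have h1 := hw (mem_univ z)
    simp only [mem_ofPred_eq, ← EReal.coe_add] at h1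
    exact EReal.coe_le_coe_iff.1 h1
  set K := 1 / (2 * γ) * ‖q - w‖ ^ 2
  set D := g q - g w - 1 / γ * inner ℝ (p - w) (q - w)
  -- First-order condition without differentiability: compare `w` with a point on the segment to
  -- `q`, divide by `t`, then let `t` tend to 0 from the right.
  have hDK : ∀ t ∈ Ioo (0 : ℝ) 1, 0 ≤ D + t * K := by
    rintro t ⟨ht0, ht1⟩
    have h1 := hmin ((1 - t) • w + t • q)
    have h2 := hg.2 (mem_univ w) (mem_univ q) (sub_nonneg.2 ht1.le) ht0.le (by ring)
    have h3 : (1 - t) • w + t • q - p = t • (q - w) - (p - w) := by module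
    have h4 : ‖w - p‖ = ‖p - w‖ := norm_sub_rev _ _
    rw [h3, h4, norm_sub_sq_real (t • (q - w)), norm_smul, real_inner_smul_left, Real.norm_of_nonneg ht0.le,
      real_inner_comm] at h1
    simp only [smul_eq_mul] at h2
    have h5 : 0 ≤ t * (D + t * K) := by
      have : t * (D + t * K) = (1 - t) * g w + t * g q - g w
          + 1 / (2 * γ) * ((t * ‖q - w‖) ^ 2 - 2 * (t * inner ℝ (p - w) (q - w))) := by
        simp only [D, K]
        field_simp
        ring
      rw [this]
      linarith
    exact nonneg_of_mul_nonneg_right h5 ht0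
  have hlim : Tendsto (fun t : ℝ => D + t * K) (𝓝[>] 0) (𝓝 (D + 0 * K)) :=
    (Continuous.tendsto (by fun_prop) 0).mono_left nhdsWithin_le_nhds
  have h0 := ge_of_tendsto hlim (by
    filter_upwards [Ioo_mem_nhdsGT (zero_lt_one' ℝ)] with t ht using hDK t ht)
  simp only [zero_mul, add_zero] at h0
  linarith

theorem convexOn_of_isLUB_inner_sub {G g : X → ℝ}
    (hg : ∀ p, IsLUB (range fun v => inner ℝ p v - G v) (g p)) : ConvexOn ℝ univ g := by
  refine ⟨convex_univ, fun x _ y _ a b ha hb hab => (hg _).2 ?_⟩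
  rintro _ ⟨v, rfl⟩
  have hx : inner ℝ x v - G v ≤ g x := (hg x).1 ⟨v, rfl⟩
  have hy : inner ℝ y v - G v ≤ g y := (hg y).1 ⟨v, rfl⟩
  have h1 : inner ℝ (a • x + b • y) v - G v
      = a * (inner ℝ x v - G v) + b * (inner ℝ y v - G v) := by
    rw [inner_add_left, real_inner_smul_left, real_inner_smul_left]
    linear_combination G v * hab
  simp only [smul_eq_mul]
  rw [h1]
  gcongr

variable [CompleteSpace X] {Y : Type*} [NormedAddCommGroup Y] [InnerProductSpace ℝ Y]
  [CompleteSpace Y]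

theorem hasGradientAt_half_norm_sq (L : X →L[ℝ] Y) (c : Y) (u : X) :
    HasGradientAt (fun v => 1 / 2 * ‖L v + c‖ ^ 2) (L.adjoint (L u + c)) u := by
  rw [hasGradientAt_iff_hasFDerivAt]
  have h := ((L.hasFDerivAt (x := u)).add_const c).norm_sq.const_mul (1 / 2 : ℝ)
  refine h.congr_fderiv ?_
  ext v
  simp [ContinuousLinearMap.adjoint_inner_left]

/-- Strong convergence of the solutions of the regularized optimality systems for a quadratic
functional plus a penalty with quadratic growth. -/
theorem exists_tendsto_of_solvesOSReg (L : X →L[ℝ] Y) (c : Y) {F G : X → ℝ}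
    (hF : ∀ v, F v = 1 / 2 * ‖L v + c‖ ^ 2) {α : ℝ} (hα : 0 < α) (hG0 : G 0 = 0)
    (hG : ∀ v, α / 2 * ‖v‖ ^ 2 ≤ G v) {γ : ℕ → ℝ} (hγ : ∀ n, 0 < γ n)
    (hγ0 : Tendsto γ atTop (𝓝 0)) {u p : ℕ → X} (h : ∀ n, SolvesOSReg F G (γ n) (u n) (p n)) :
    ∃ ubar pbar : X, SolvesOS F G ubar pbar ∧ Tendsto u atTop (𝓝 ubar) ∧
      Tendsto p atTop (𝓝 pbar) := by
  obtain rfl : F = fun v => 1 / 2 * ‖L v + c‖ ^ 2 := funext hF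
  obtain ⟨g, hgeq, hg, hgb⟩ := exists_fenchelConj_eq_coe hα hG0 hG
  have hp : ∀ n, p n = -L.adjoint (L (u n) + c) := fun n =>
    neg_eq_iff_eq_neg.1 ((h n).1.unique (hasGradientAt_half_norm_sq L c (u n)))
  have hsub : ∀ n q, g (p n - γ n • u n) + inner ℝ (u n) (q - (p n - γ n • u n)) ≤ g q := by
    intro n q
    have h1 := (h n).2
    rw [hgeq] at h1
    exact h1.inner_le (convexOn_of_isLUB_inner_sub hg) (hγ n) q
  have hbound : ∀ n, ‖u n‖ ≤ 2 / α * ‖L.adjoint c‖ := by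
    intro n
    -- The point `α • u n` maximizes ⟨u_n, q⟩ - ‖q‖²/(2α), hence gives the best bound from the
    -- quadratic majorant of G*.
    have h1 := hsub n (α • u n)
    have h2 := (hgb (α • u n)).2
    have h3 := (hgb (p n - γ n • u n)).1
    have h4 : inner ℝ (u n) (p n) = -‖L (u n)‖ ^ 2 - inner ℝ (u n) (L.adjoint c) := by
      rw [hp, inner_neg_right, map_add, inner_add_right, ContinuousLinearMap.adjoint_inner_right,
        real_inner_self_eq_norm_sq]
      ring
    have h5 := abs_le.1 (abs_real_inner_le_norm (u n) (L.adjoint c))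
    simp only [inner_sub_right, real_inner_smul_right, real_inner_self_eq_norm_sq] at h1
    rw [norm_smul, Real.norm_of_nonneg hα.le] at h2
    have h6 : 1 / (2 * α) * (α * ‖u n‖) ^ 2 = α / 2 * ‖u n‖ ^ 2 := by field_simp
    have h7 : 0 ≤ γ n * ‖u n‖ ^ 2 := mul_nonneg (hγ n).le (sq_nonneg _)
    have h8 : ‖u n‖ * (α / 2 * ‖u n‖) ≤ ‖u n‖ * ‖L.adjoint c‖ := by
      nlinarith [sq_nonneg ‖L (u n)‖, h5.1]
    rcases (norm_nonneg (u n)).eq_or_lt with h0 | h0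
    · rw [← h0]; positivity
    · have h9 := le_of_mul_le_mul_left h8 h0
      rw [div_mul_eq_mul_div, le_div_iff₀ hα]
      linarith
  have hmono : ∀ n m, inner ℝ (γ n • u n - γ m • u m) (u n - u m) ≤ 0 := by
    intro n m
    have h1 := hsub n (p m - γ m • u m)
    have h2 := hsub m (p n - γ n • u n)
    have h3 : inner ℝ (p n - p m) (u n - u m) = -‖L (u n - u m)‖ ^ 2 := by
      have : p n - p m = -L.adjoint (L (u n - u m)) := by
        rw [hp, hp]; simp only [map_add, map_sub]; abel
      rw [this, inner_neg_left, ContinuousLinearMap.adjoint_inner_left, real_inner_self_eq_norm_sq]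
    have h4 : inner ℝ (γ n • u n - γ m • u m) (u n - u m) = inner ℝ (p n - p m) (u n - u m)
        + inner ℝ (u n) (p m - γ m • u m - (p n - γ n • u n))
        + inner ℝ (u m) (p n - γ n • u n - (p m - γ m • u m)) := by
      rw [real_inner_comm, real_inner_comm (u n - u m) (p n - p m)]
      simp only [inner_sub_left, inner_sub_right]
      ring
    rw [h4, h3]
    linarith [sq_nonneg ‖L (u n - u m)‖]
  obtain ⟨ubar, hu⟩ := cauchySeq_tendsto_of_complete
    (cauchySeq_of_inner_smul_sub_nonpos hγ hγ0 hbound hmono)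
  have hpt : Tendsto p atTop (𝓝 (-L.adjoint (L ubar + c))) := by
    rw [funext hp]
    exact ((by fun_prop : Continuous fun v => -L.adjoint (L v + c)).tendsto ubar).comp hu
  refine ⟨ubar, -L.adjoint (L ubar + c), ⟨?_, fun q => ?_⟩, hu, hpt⟩
  · rw [neg_neg]; exact hasGradientAt_half_norm_sq L c ubar
  · rw [hgeq]
    set pbar := -L.adjoint (L ubar + c)
    have hw : Tendsto (fun n => p n - γ n • u n) atTop (𝓝 pbar) := by
      simpa using hpt.sub (hγ0.smul hu)
    rw [← EReal.coe_add, EReal.coe_le_coe_iff, ← le_sub_iff_add_le]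
    -- It is enough to bound each affine minorant at `pbar`, so no continuity of `g` is needed.
    refine (hg pbar).2 ?_
    rintro _ ⟨v, rfl⟩
    have hlim := ((hw.inner (tendsto_const_nhds (x := v))).sub_const (G v)).add
      (hu.inner ((tendsto_const_nhds (x := q)).sub hw))
    rw [le_sub_iff_add_le]
    refine le_of_tendsto hlim (Eventually.of_forall fun n => ?_)
    exact (add_le_add_left ((hg _).1 ⟨v, rfl⟩) _).trans (hsub n q)

end Convex

/-! ### The tracking and penalty functionals in L² -/

theorem exists_restriction_clm {Z : Type*} [MeasurableSpace Z] {μ ν : Measure Z} {s : Set Z}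
    (h : ν = μ.restrict s) :
    ∃ R : Lp ℝ 2 μ →L[ℝ] Lp ℝ 2 ν, ∀ f, R f =ᵐ[ν] f := by
  subst h
  exact ⟨LpToLpRestrictCLM Z ℝ ℝ μ 2 s, fun f => LpToLpRestrictCLM_coeFn ℝ s f⟩

theorem integral_sq_eq_norm_sq {Z : Type*} [MeasurableSpace Z] {μ : Measure Z} (f : Lp ℝ 2 μ) :
    ∫ z, f z ^ 2 ∂μ = ‖f‖ ^ 2 := by
  rw [← real_inner_self_eq_norm_sq, L2.inner_def]
  simp [pow_two]

/-- Up to restriction, the tracking functional is a squared norm of an affine map. -/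
theorem exists_trackingF_eq {d N : ℕ} {T : ℝ} {Ω ωobs : Set (Eucl d)}
    (hobs : MeasurableSet ωobs) (hobsΩ : ωobs ⊆ Ω) (S : Control T N →ᴬ[ℝ] SpaceTimeL2 T Ω)
    (yd : SpaceTimeL2 T ωobs) :
    ∃ (L : Control T N →L[ℝ] SpaceTimeL2 T ωobs) (c : SpaceTimeL2 T ωobs),
      ∀ u, trackingF S yd u = 1 / 2 * ‖L u + c‖ ^ 2 := by
  have hmeas : volume.restrict (spaceTime T ωobs)
      = (volume.restrict (spaceTime T Ω)).restrict (spaceTime T ωobs) := by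
    have hsub : spaceTime T ωobs ⊆ spaceTime T Ω := prod_mono_right hobsΩ
    have hm : MeasurableSet (spaceTime T ωobs) := measurableSet_Ioo.prod hobs
    rw [Measure.restrict_restrict hm, inter_eq_left.2 hsub]
  obtain ⟨R, hR⟩ := exists_restriction_clm hmeas
  refine ⟨R ∘L S.contLinear, R (S 0) - yd, fun u => ?_⟩
  have hS : S u = S.contLinear u + S 0 := by
    simpa using S.map_vadd 0 u
  have h1 : (R ∘L S.contLinear) u + (R (S 0) - yd) = R (S u) - yd := by
    rw [hS, map_add, ContinuousLinearMap.comp_apply]; abel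
  rw [h1, ← integral_sq_eq_norm_sq, trackingF]
  congr 1
  refine integral_congr_ae ?_
  filter_upwards [Lp.coeFn_sub (R (S u)) yd, hR (S u)] with z hz1 hz2
  rw [hz1, Pi.sub_apply, hz2]

theorem penaltyG_zero {N : ℕ} {T : ℝ} (α : ℝ) : penaltyG α (0 : Control T N) = 0 := by
  have h : ∫ t in Ioo (0 : ℝ) T, (∑ j, |(0 : Control T N) t j|) ^ 2 = 0 := by
    refine integral_eq_zero_of_ae ?_
    filter_upwards [Lp.coeFn_zero (Eucl N) 2 (volume.restrict (Ioo (0 : ℝ) T))] with t ht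
    have ht' : (0 : Control T N) t = 0 := ht
    simp only [ht']
    simp
  rw [penaltyG, h, mul_zero]

/-- Pointwise in time, the ℓ¹ norm dominates the Euclidean norm. Integrability of the squared ℓ¹
norm is what allows integrating this inequality. -/
theorem half_mul_norm_sq_le_penaltyG {N : ℕ} {T α : ℝ} (hα : 0 < α) (u : Control T N) :
    α / 2 * ‖u‖ ^ 2 ≤ penaltyG α u := by
  have hu : MemLp u 2 (volume.restrict (Ioo (0 : ℝ) T)) := Lp.memLp u
  have hcoord : ∀ j, MemLp (fun t => |u t j|) 2 (volume.restrict (Ioo (0 : ℝ) T)) := fun j =>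
    (hu.of_le ((EuclideanSpace.proj (𝕜 := ℝ) j).continuous.comp_aestronglyMeasurable hu.1)
      (Eventually.of_forall fun t => PiLp.norm_apply_le (u t) j)).abs
  have hint : Integrable (fun t => (∑ j, |u t j|) ^ 2) (volume.restrict (Ioo (0 : ℝ) T)) :=
    (memLp_finsetSum Finset.univ fun j _ => hcoord j).integrable_sq
  rw [penaltyG, ← real_inner_self_eq_norm_sq, L2.inner_def]
  refine mul_le_mul_of_nonneg_left ?_ (by positivity)
  refine integral_mono_ae (L2.integrable_inner u u) hint (Eventually.of_forall fun t => ?_)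
  simp only [real_inner_self_eq_norm_sq, EuclideanSpace.real_norm_sq_eq, ← sq_abs (u t _)]
  exact Finset.sum_sq_le_sq_sum_of_nonneg fun j _ => abs_nonneg _

end SwitchingControl

theorem mainTheorem5 {d N : ℕ} (T α : ℝ) (hT : 0 < T) (hα : 0 < α)
    (Ω : Set (SwitchingControl.Eucl d)) (hΩ : IsOpen Ω)
    (A : SwitchingControl.EllipticOperator Ω)
    (ω : Fin N → Set (SwitchingControl.Eucl d))
    (hω : ∀ i, MeasurableSet (ω i) ∧ ω i ⊆ Ω ∧ 0 < volume (ω i))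
    (ωobs : Set (SwitchingControl.Eucl d)) (hobs : MeasurableSet ωobs) (hobsΩ : ωobs ⊆ Ω)
    (y₀ : Lp ℝ 2 (volume.restrict Ω))
    (bc : Set (SwitchingControl.SpaceTimeL2 T Ω))
    (S : SwitchingControl.Control T N →ᴬ[ℝ] SwitchingControl.SpaceTimeL2 T Ω)
    (hS : SwitchingControl.IsSolutionOperator A ω y₀ bc S)
    (yd : SwitchingControl.SpaceTimeL2 T ωobs)
    (γ : ℕ → ℝ) (hγ : ∀ n, 0 < γ n) (hγ0 : Tendsto γ atTop (𝓝 0))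
    (u p : ℕ → SwitchingControl.Control T N)
    (hup : ∀ n, SwitchingControl.SolvesOSReg (SwitchingControl.trackingF S yd)
      (SwitchingControl.penaltyG α) (γ n) (u n) (p n)) :
    ∃ ubar pbar : SwitchingControl.Control T N,
      SwitchingControl.SolvesOS (SwitchingControl.trackingF S yd)
        (SwitchingControl.penaltyG α) ubar pbar ∧
      Tendsto (fun n => toWeakSpace ℝ
          (SwitchingControl.Control T N × SwitchingControl.Control T N) (u n, p n))
        atTop (𝓝 (toWeakSpace ℝ
          (SwitchingControl.Control T N × SwitchingControl.Control T N) (ubar, pbar))) := by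
  obtain ⟨L, c, hF⟩ := SwitchingControl.exists_trackingF_eq hobs hobsΩ S yd
  obtain ⟨ubar, pbar, hOS, hu, hp⟩ := SwitchingControl.exists_tendsto_of_solvesOSReg L c hF hα
    (SwitchingControl.penaltyG_zero α) (SwitchingControl.half_mul_norm_sq_le_penaltyG hα) hγ hγ0 hup
  exact ⟨ubar, pbar, hOS, ((toWeakSpaceCLM ℝ _).continuous.tendsto (ubar, pbar)).comp
    (hu.prodMk_nhds hp)⟩
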